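/- **Setting.** Let $Y = X\beta + \epsilon$ with $X\in\mathbb{R}^{n\times p}$, $\beta\in\mathbb{R}^p$, $\epsilon\in\mathbb{R}^n$. The entries of $X$ are independent and sub-Gaussian with mean $0$ and scale $1$, i.e. $\mathbb{E}e^{tX_{\ell j}}\le e^{t^2/2}$ for all $t\in\mathbb{R}$. The noise $\epsilon$ is independent of $X$ and has independent sub-Gaussian entries with mean $0$ and scale $\sigma>0$, i.e. $\mathbb{E}e^{t\epsilon_\ell}\le e^{\sigma^2t^2/2}$ for all $t\in\mathbb{R}$. Let $S_0=\{j:\beta_j\neq 0\}$, $k=|S_0|\ge 0$, and let $\bar k$ be an integer with $\bar k\ge\max\{k,1\}$. Let $\lambda_{max}\ge\lambda_{min}>0$ and $\lambda>0$ be constants, where $\lambda_{min}\le 1$ if $k\ge 1$. Let $\mathcal{E}_{cond}$ be the event that at least one of the following fails: * Condition 1: $\lambda_{max}\|v\|^2\ge\|X_{S_0}v\|^2/n\ge\lambda_{min}\|v\|^2$ for all $v\in\mathbb{R}^{S_0}$, where $X_{S_0}$ is the submatrix of the columns of $X$ with index in $S_0$; * Condition 2: $\|\epsilon\|^2/n\le\sigma^2\lambda$.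 **Algorithm.** Orthogonal Matching Pursuit (OMP) with threshold $\tau$ starts with $d(0)=\emptyset$, $R_0=Y$. In step $i\ge1$ put $\mathcal{Z}_{ij}=X_j^{T}R_{i-1}/\|R_{i-1}\|$ for $j\notin d(i-1)$ (and $\mathcal{Z}_{ij}=0$ if $R_{i-1}=0$). If $\max_{j\notin d(i-1)}|\mathcal{Z}_{ij}|>\tau$, let $a(i)$ be an index attaining the maximum (ties being broken by an arbitrary fixed rule that selects an element from the set of maximizers), set $d(i)=d(i-1)\cup\{a(i)\}$, let $R_i$ be the residual of the orthogonal projection of $Y$ onto the span of the columns $X_j$, $j\in d(i)$, and continue; otherwise (or if no index is left) stop and output $\hat S=d(i-1)$. Let $\hat F=S_0\setminus\hat S$. **Constants.** For $a,\alpha,\delta>0$ let $\tau=\sqrt{2(1+a)\log p}$, $$r_1=\frac{\max\{\lambda_{max},\lambda\}}{\lambda_{min}^3},\quad r_2=\frac1{\sqrt{\lambda_{min}}}+\sqrt{r_1},\quad f(\delta)=\frac1{(1-1/\sqrt{1+\delta})^2},\quad \xi=\max\Big\{(1+\delta)r_1,\ \frac{\sigma^2r_2^2f(\delta)}{\bar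 k\alpha}\Big\},$$ and $P_{err}(k)=\mathbb{P}(\mathcal{E}_{cond})+2(k+1)/p^a+2k/p^{1+a}$ for $k\ge1$, $P_{err}(0)=2/p^a$. **Theorem.** Let $n=\xi\bar k\tau^2$ and run OMP with threshold $\tau$. 1. If $k\ge1$, then, except on a set of probability at most $P_{err}(k)$, $$\hat S\subseteq S_0\quad\text{and}\quad\sum_{j\in\hat F}\beta_j^2\le\alpha|\hat F|.$$ In particular, if $|\beta_j|\ge\beta_{min}>0$ for all $j\in S_0$ and $\beta_{min}^2>\alpha$, then $\hat S=S_0$ with probability at least $1-P_{err}(k)$. 2. If $k=0$, then $\hat S=\emptyset$ with probability at least $1-P_{err}(0)$. -/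

import Mathlib

open MeasureTheory ProbabilityTheory
open scoped NNReal Matrix

namespace OMP

noncomputable section

section Algorithm

variable {n : ℕ} {ι : Type*} [Fintype ι] [DecidableEq ι]

/-- The column `X_j`, as a vector of Euclidean space. -/
def column (X : Matrix (Fin n) ι ℝ) (j : ι) : EuclideanSpace ℝ (Fin n) :=
  WithLp.toLp 2 (fun i => X i j)

/-- The residual `(I - P_d) Y`, where `P_d` is the orthogonal projection onto the span of the
columns with index in `d`. For `d = ∅` this is `Y`. -/
def residual (X : Matrix (Fin n) ι ℝ) (Y : EuclideanSpace ℝ (Fin n)) (d : Finset ι) :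
    EuclideanSpace ℝ (Fin n) :=
  Y - (Submodule.span ℝ (column X '' (d : Set ι))).starProjection Y

/-- The statistic `X_jᵀ R / ‖R‖`, where `R` is the residual after the columns in `d` have been
detected. It is `0` if `R = 0` (so that the algorithm stops at a perfect fit). -/
def stat (X : Matrix (Fin n) ι ℝ) (Y : EuclideanSpace ℝ (Fin n)) (d : Finset ι) (j : ι) : ℝ :=
  inner ℝ (column X j) (residual X Y d) / ‖residual X Y d‖

open Classical in
/-- The set of undetected indices at which the absolute value of the statistic is maximal. -/
def maximizers (X : Matrix (Fin n) ι ℝ) (Y : EuclideanSpace ℝ (Fin n)) (d : Finset ι) :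
    Finset ι :=
  dᶜ.filter (fun j => ∀ l ∈ dᶜ, |stat X Y d l| ≤ |stat X Y d j|)

open Classical in
/-- One step of Orthogonal Matching Pursuit with threshold `τ`, from the detected set `d`: if the
maximum of the absolute statistic over the undetected indices exceeds `τ`, a maximizer is added,
otherwise nothing changes any more. The rule `sel` picks one index among tied maximizers. -/
def step (sel : Finset ι → ι) (X : Matrix (Fin n) ι ℝ) (Y : EuclideanSpace ℝ (Fin n)) (τ : ℝ)
    (d : Finset ι) : Finset ι :=
  if ∃ j ∈ dᶜ, τ < |stat X Y d j| then insert (sel (maximizers X Y d)) d else d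

/-- The output `Ŝ(Y, X, τ)`. Every step that does not stop detects a new index, so the algorithm
has stopped after at most as many steps as there are columns. -/
def support (sel : Finset ι → ι) (X : Matrix (Fin n) ι ℝ) (Y : EuclideanSpace ℝ (Fin n))
    (τ : ℝ) : Finset ι :=
  (step sel X Y τ)^[Fintype.card ι] ∅

end Algorithm

section Model

variable {n p : ℕ}

/-- The support `S₀(β) = {j : β_j ≠ 0}`. -/
def trueSupport (β : Fin p → ℝ) : Finset (Fin p) :=
  Finset.univ.filter (fun j => β j ≠ 0)

/-- The response `Y = X β + ε`. -/
def response (X : Matrix (Fin n) (Fin p) ℝ) (β : Fin p → ℝ) (ε : Fin n → ℝ) :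
    EuclideanSpace ℝ (Fin n) :=
  WithLp.toLp 2 (X *ᵥ β + ε)

/-- `lamMax ‖v‖² ≥ ‖X_S v‖² / n ≥ lamMin ‖v‖²` for all `v`, where `X_S` consists of the columns of
`X` with index in `S`. -/
def Condition1 (X : Matrix (Fin n) (Fin p) ℝ) (S : Finset (Fin p)) (lamMin lamMax : ℝ) : Prop :=
  ∀ v : EuclideanSpace ℝ S,
    ‖(WithLp.toLp 2 (X.submatrix id (Subtype.val : S → Fin p) *ᵥ (fun j => v j)) :
        EuclideanSpace ℝ (Fin n))‖ ^ 2 / n ≤ lamMax * ‖v‖ ^ 2 ∧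
    lamMin * ‖v‖ ^ 2 ≤
      ‖(WithLp.toLp 2 (X.submatrix id (Subtype.val : S → Fin p) *ᵥ (fun j => v j)) :
        EuclideanSpace ℝ (Fin n))‖ ^ 2 / n

/-- `‖ε‖² / n ≤ σ² lam`. -/
def Condition2 (ε : Fin n → ℝ) (σ lam : ℝ) : Prop :=
  ‖(WithLp.toLp 2 ε : EuclideanSpace ℝ (Fin n))‖ ^ 2 / n ≤ σ ^ 2 * lam

/-- The event that `Condition1` (for `S = S₀(β)`) or `Condition2` fails. -/
def condFails {Ω : Type*} (X : Ω → Matrix (Fin n) (Fin p) ℝ) (ε : Ω → Fin n → ℝ)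
    (β : Fin p → ℝ) (σ lamMin lamMax lam : ℝ) : Set Ω :=
  {ω | ¬ (Condition1 (X ω) (trueSupport β) lamMin lamMax ∧ Condition2 (ε ω) σ lam)}

end Model

section Constants

def threshold (a : ℝ) (p : ℕ) : ℝ := √(2 * (1 + a) * Real.log p)

def r₁ (lamMin lamMax lam : ℝ) : ℝ := max lamMax lam / lamMin ^ 3

def r₂ (lamMin lamMax lam : ℝ) : ℝ := 1 / √lamMin + √(r₁ lamMin lamMax lam)

def f (δ : ℝ) : ℝ := 1 / (1 - 1 / √(1 + δ)) ^ 2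

def ξ (σ lamMin lamMax lam : ℝ) (kbar : ℕ) (α δ : ℝ) : ℝ :=
  max ((1 + δ) * r₁ lamMin lamMax lam) (σ ^ 2 * r₂ lamMin lamMax lam ^ 2 * f δ / (kbar * α))

/-- The bound on the probability of failure; `pcond` stands for the probability that one of the
two conditions fails. -/
def Perr (pcond a : ℝ) (p k : ℕ) : ℝ :=
  if k = 0 then 2 / (p : ℝ) ^ a
  else pcond + 2 * (k + 1) / (p : ℝ) ^ a + 2 * k / (p : ℝ) ^ (1 + a)

end Constants

end

end OMP

/-!
Let `S` be the true support of `β`, of cardinality `k`, and `τ` the threshold.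

*No false positives.* Run the algorithm on the design in which the columns outside `S` are replaced
by zero columns (`restrictColumns`). This run is a function of the columns in `S` and the noise, it
never leaves `S`, and it is stationary after `k` steps. A column outside `S` is independent of all
of its residuals, so by Fubini and the sub-Gaussian tail bound its correlation with a given
normalized residual exceeds `τ` with probability at most `2 exp (-τ² / 2) = 2 / p ^ (1 + a)`
(`measure_stat_gt_le`). With `k + 1` residuals and at most `p` columns, outside an event of
probability at most `2 (k + 1) / p ^ a` no such correlation exceeds `τ`. Then the actual run
coincides with the restricted one (`support_subset_and_stat_le`): it stops inside `S`, at a set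
where all remaining statistics are at most `τ`.

*The noise.* Decompose the noise as `X_S η + e` with `e` orthogonal to the columns in `S`. The
coefficient `η_j` is the noise tested against the part `q_j` of `X_j` that is orthogonal to the other
columns in `S`, divided by `‖q_j‖²`. Since `‖q_j‖² ≥ n lamMin`, the bound `|η_j| ≤ σ τ / √(n lamMin)`
holds for all `j ∈ S` outside an event of probability at most `2 k / p ^ (1 + a)`
(`measure_noise_gt_le`, `exists_leastSquares_coeff`).

*The stopping rule.* Suppose the run stops at `d ⊆ S`, and put `F = S \ d` and `b = β + η`. The
residual is `w + e`, where `w` is the projection of `X_F b_F` off the columns in `d`. Expanding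
`‖w‖²` in the columns of `F`, each of which has inner product at most `τ ‖w + e‖` with `w`, and using
`‖w‖² ≥ n lamMin ‖b_F‖²`, bounds `‖w‖²` by a small multiple of `‖w‖² + ‖e‖²`
(`exists_sq_norm_bound_of_stat_le`). The sample size makes this multiple at most `1 / (1 + δ)`, which
bounds `‖b_F‖`, and `‖β_F‖ ≤ ‖b_F‖ + ‖η_F‖` gives the claim (`sum_missed_sq_le`).

Measurability of the run follows from the Gram–Schmidt recursion `residual_insert`.
-/

namespace OMP

/-! ### Residuals of orthogonal projections onto spans of columns -/

section Residual

variable {n : ℕ} {ι : Type*}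
  (X : Matrix (Fin n) ι ℝ) (Y : EuclideanSpace ℝ (Fin n)) (d : Finset ι)

lemma sub_residual_mem_span : Y - residual X Y d ∈ Submodule.span ℝ (column X '' (d : Set ι)) := by
  simp [residual]

variable {X Y d}

lemma inner_residual_of_mem_span {v : EuclideanSpace ℝ (Fin n)}
    (hv : v ∈ Submodule.span ℝ (column X '' (d : Set ι))) : inner ℝ v (residual X Y d) = 0 := by
  rw [real_inner_comm]
  exact Submodule.starProjection_inner_eq_zero _ _ hv

lemma inner_column_residual {j : ι} (hj : j ∈ d) :
    inner ℝ (column X j) (residual X Y d) = 0 :=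
  inner_residual_of_mem_span (Submodule.subset_span ⟨j, hj, rfl⟩)

lemma inner_eq_zero_of_mem_span {r v : EuclideanSpace ℝ (Fin n)}
    (hr : ∀ j ∈ d, inner ℝ (column X j) r = 0)
    (hv : v ∈ Submodule.span ℝ (column X '' (d : Set ι))) : inner ℝ v r = 0 := by
  induction hv using Submodule.span_induction with
  | mem x h => obtain ⟨j, hj, rfl⟩ := h; exact hr j hj
  | zero => simp
  | add x y _ _ hx hy => rw [inner_add_left, hx, hy, add_zero]
  | smul a x _ hx => rw [real_inner_smul_left, hx, mul_zero]

/-- The residual is the only vector that is orthogonal to the columns and differs from `Y` by an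
element of their span. -/
lemma residual_eq_of_mem_span {r : EuclideanSpace ℝ (Fin n)}
    (hr : ∀ j ∈ d, inner ℝ (column X j) r = 0)
    (hv : Y - r ∈ Submodule.span ℝ (column X '' (d : Set ι))) : residual X Y d = r := by
  have h := Submodule.eq_starProjection_of_mem_of_inner_eq_zero (u := Y) hv (fun w hw => by
    rw [sub_sub_cancel, real_inner_comm]; exact inner_eq_zero_of_mem_span hr hw)
  rw [residual, h, sub_sub_cancel]

lemma residual_add (Y' : EuclideanSpace ℝ (Fin n)) :
    residual X (Y + Y') d = residual X Y d + residual X Y' d := by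
  simp only [residual, map_add]; abel

lemma residual_eq_self (h : ∀ j ∈ d, inner ℝ (column X j) Y = 0) : residual X Y d = Y :=
  residual_eq_of_mem_span h (by simp)

@[simp] lemma residual_empty : residual X Y ∅ = Y :=
  residual_eq_self (by simp)

lemma residual_congr {X' : Matrix (Fin n) ι ℝ} (h : ∀ j ∈ d, column X j = column X' j) :
    residual X Y d = residual X' Y d := by
  have : column X '' (d : Set ι) = column X' '' (d : Set ι) := Set.image_congr h
  simp only [residual, this]

/-- One step of the Gram–Schmidt recursion. If `X_j` lies in the span of the columns in `d`, the
quotient is `0 / 0 = 0`, which is the right coefficient. -/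
lemma residual_insert [DecidableEq ι] (j : ι) : residual X Y (insert j d) = residual X Y d -
    (inner ℝ (residual X (column X j) d) (residual X Y d) / ‖residual X (column X j) d‖ ^ 2) •
      residual X (column X j) d := by
  set q := residual X (column X j) d with hq
  set R := residual X Y d with hR
  have hle : Submodule.span ℝ (column X '' (d : Set ι)) ≤
      Submodule.span ℝ (column X '' ((insert j d : Finset ι) : Set ι)) :=
    Submodule.span_mono (Set.image_mono (by simp))
  have hqmem : q ∈ Submodule.span ℝ (column X '' ((insert j d : Finset ι) : Set ι)) := by
    have h1 := hle (sub_residual_mem_span X (column X j) d)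
    have h2 : column X j ∈ Submodule.span ℝ (column X '' ((insert j d : Finset ι) : Set ι)) :=
      Submodule.subset_span ⟨j, by simp, rfl⟩
    simpa [hq] using Submodule.sub_mem _ h2 h1
  -- `X_j` and `q` differ by an element of the span, hence have equal inner products with residuals
  have hcol : ∀ Z, inner ℝ (column X j) (residual X Z d) = inner ℝ q (residual X Z d) := by
    intro Z
    have := inner_residual_of_mem_span (Y := Z) (sub_residual_mem_span X (column X j) d)
    rw [inner_sub_left] at this
    linarith
  apply residual_eq_of_mem_span
  · intro l hl
    rw [Finset.mem_insert] at hl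
    rw [inner_sub_right, real_inner_smul_right]
    rcases hl with rfl | hl
    · rw [hR, hcol, hq, hcol, ← hq, ← hR, real_inner_self_eq_norm_sq]
      by_cases h0 : q = 0
      · simp [h0]
      · have : ‖q‖ ^ 2 ≠ 0 := by simpa using h0
        field_simp
        ring
    · rw [hR, hq, inner_column_residual hl, inner_column_residual hl]; simp
  · rw [← sub_add]
    exact Submodule.add_mem _ (hle (sub_residual_mem_span X Y d)) (Submodule.smul_mem _ _ hqmem)

end Residual

/-! ### Measurability of the algorithm -/

section Measurability

variable {T : Type*} [MeasurableSpace T] {n p : ℕ}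
  {X : T → Matrix (Fin n) (Fin p) ℝ} {Y : T → EuclideanSpace ℝ (Fin n)}

lemma measurable_column (hX : ∀ i j, Measurable fun t => X t i j) (j : Fin p) :
    Measurable fun t => column (X t) j :=
  (WithLp.measurable_toLp 2 (Fin n → ℝ)).comp (measurable_pi_lambda _ fun i => hX i j)

lemma measurable_residual (hX : ∀ i j, Measurable fun t => X t i j) (hY : Measurable Y)
    (d : Finset (Fin p)) : Measurable fun t => residual (X t) (Y t) d := by
  induction d using Finset.induction_on generalizing Y with
  | empty => simpa using hY
  | insert j d _ ih =>
    simp only [residual_insert]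
    have h1 := ih hY
    have h2 := ih (measurable_column hX j)
    exact h1.sub (((h2.inner h1).div (h2.norm.pow_const 2)).smul h2)

lemma measurable_stat (hX : ∀ i j, Measurable fun t => X t i j) (hY : Measurable Y)
    (d : Finset (Fin p)) (j : Fin p) : Measurable fun t => stat (X t) (Y t) d j :=
  ((measurable_column hX j).inner (measurable_residual hX hY d)).div
    (measurable_residual hX hY d).norm

/-- `Finset (Fin p)` carries the discrete σ-algebra `⊤`, and the maximizers take countably many
values, so the tie-breaking rule `sel` may be arbitrary. -/
lemma measurable_step (sel : Finset (Fin p) → Fin p) (hX : ∀ i j, Measurable fun t => X t i j)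
    (hY : Measurable Y) (τ : ℝ) (d : Finset (Fin p)) :
    Measurable[_, ⊤] fun t => step sel (X t) (Y t) τ d := by
  let _ : MeasurableSpace (Finset (Fin p)) := ⊤
  have hst := fun j => (measurable_stat hX hY d j).abs
  have hmax : Measurable fun t => maximizers (X t) (Y t) d := by
    refine measurable_to_countable' fun s => ?_
    have : (fun t => maximizers (X t) (Y t) d) ⁻¹' {s} =
        {t | ∀ j, (j ∈ dᶜ ∧ ∀ l ∈ dᶜ, |stat (X t) (Y t) d l| ≤ |stat (X t) (Y t) d j|) ↔ j ∈ s} := by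
      ext t
      simp [maximizers, Finset.ext_iff]
    rw [this]
    refine measurableSet_setOfPred.2 (Measurable.forall fun j => Measurable.iff
      (measurable_const.and (Measurable.forall fun l => measurable_const.imp ?_)) measurable_const)
    exact measurableSet_setOfPred.1 (measurableSet_le (hst l) (hst j))
  refine Measurable.ite ?_ ?_ measurable_const
  · refine measurableSet_setOfPred.2 (Measurable.exists fun j => measurable_const.and ?_)
    exact measurableSet_setOfPred.1 (measurableSet_lt measurable_const (hst j))
  · exact (measurable_from_top (f := fun s => insert (sel s) d)).comp hmax

lemma measurable_iterate_step (sel : Finset (Fin p) → Fin p)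
    (hX : ∀ i j, Measurable fun t => X t i j) (hY : Measurable Y) (τ : ℝ) (i : ℕ) :
    Measurable[_, ⊤] fun t => (step sel (X t) (Y t) τ)^[i] ∅ := by
  let _ : MeasurableSpace (Finset (Fin p)) := ⊤
  induction i with
  | zero => exact measurable_const
  | succ i ih =>
    simp only [Function.iterate_succ_apply']
    have h : Measurable fun q : T × Finset (Fin p) => step sel (X q.1) (Y q.1) τ q.2 :=
      measurable_from_prod_countable_left fun d => measurable_step sel hX hY τ d
    exact h.comp (measurable_id.prodMk ih)

lemma measurable_residual_iterate_step (sel : Finset (Fin p) → Fin p)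
    (hX : ∀ i j, Measurable fun t => X t i j) (hY : Measurable Y) (τ : ℝ) (i : ℕ) :
    Measurable fun t => residual (X t) (Y t) ((step sel (X t) (Y t) τ)^[i] ∅) := by
  let _ : MeasurableSpace (Finset (Fin p)) := ⊤
  have h : Measurable fun q : T × Finset (Fin p) => residual (X q.1) (Y q.1) q.2 :=
    measurable_from_prod_countable_left fun d => measurable_residual hX hY d
  exact h.comp (measurable_id.prodMk (measurable_iterate_step sel hX hY τ i))

end Measurability

/-! ### The algorithm on a subset of the columns -/

section Restrict

variable {n : ℕ} {ι : Type*} [DecidableEq ι]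

/-- The matrix `X` with all columns outside `S` replaced by zero columns. -/
def restrictColumns (S : Finset ι) (X : Matrix (Fin n) ι ℝ) : Matrix (Fin n) ι ℝ :=
  Matrix.of fun i j => if j ∈ S then X i j else 0

variable {S d : Finset ι} {X : Matrix (Fin n) ι ℝ} {Y : EuclideanSpace ℝ (Fin n)}
  {sel : Finset ι → ι} {τ : ℝ} {j : ι}

lemma column_restrictColumns_of_mem (hj : j ∈ S) : column (restrictColumns S X) j = column X j := by
  simp [column, restrictColumns, hj]

lemma column_restrictColumns_of_notMem (hj : j ∉ S) : column (restrictColumns S X) j = 0 := by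
  ext i
  simp [column, restrictColumns, hj]

lemma residual_restrictColumns (hd : d ⊆ S) :
    residual (restrictColumns S X) Y d = residual X Y d :=
  residual_congr fun _ hj => column_restrictColumns_of_mem (hd hj)

lemma stat_restrictColumns (hd : d ⊆ S) (j : ι) :
    stat (restrictColumns S X) Y d j = if j ∈ S then stat X Y d j else 0 := by
  unfold stat
  rw [residual_restrictColumns hd]
  split_ifs with hj
  · rw [column_restrictColumns_of_mem hj]
  · rw [column_restrictColumns_of_notMem hj]; simp

variable [Fintype ι]

lemma mem_maximizers : j ∈ maximizers X Y d ↔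
    j ∉ d ∧ ∀ l ∉ d, |stat X Y d l| ≤ |stat X Y d j| := by
  simp [maximizers]

lemma sel_mem_maximizers (hsel : ∀ s : Finset ι, s.Nonempty → sel s ∈ s) (hj : j ∉ d) :
    sel (maximizers X Y d) ∈ maximizers X Y d := by
  apply hsel
  obtain ⟨m, hm, hmax⟩ := Finset.exists_max_image dᶜ (fun l => |stat X Y d l|) ⟨j, by simpa using hj⟩
  exact ⟨m, mem_maximizers.2 ⟨by simpa using hm, fun l hl => hmax l (by simpa using hl)⟩⟩

lemma card_step (hsel : ∀ s : Finset ι, s.Nonempty → sel s ∈ s) :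
    (step sel X Y τ d = d ∧ ∀ j ∉ d, |stat X Y d j| ≤ τ) ∨
      (step sel X Y τ d).card = d.card + 1 := by
  by_cases h : ∃ j ∈ dᶜ, τ < |stat X Y d j|
  · right
    rw [step, if_pos h]
    obtain ⟨j, hj, -⟩ := h
    exact Finset.card_insert_of_notMem
      (mem_maximizers.1 (sel_mem_maximizers hsel (by simpa using hj))).1
  · left
    refine ⟨by rw [step, if_neg h], fun j hj => ?_⟩
    by_contra! hlt
    exact h ⟨j, by simpa using hj, hlt⟩

lemma le_card_iterate_step (hsel : ∀ s : Finset ι, s.Nonempty → sel s ∈ s) (i : ℕ) :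
    step sel X Y τ ((step sel X Y τ)^[i] ∅) = (step sel X Y τ)^[i] ∅ ∨
      i ≤ ((step sel X Y τ)^[i] ∅).card := by
  induction i with
  | zero => simp
  | succ i ih =>
    rw [Function.iterate_succ_apply']
    rcases ih with h | h
    · left; rw [h, h]
    · rcases card_step (X := X) (Y := Y) (τ := τ) (d := (step sel X Y τ)^[i] ∅) hsel with h' | h'
      · left; rw [h'.1, h'.1]
      · right; omega

lemma step_restrictColumns_subset (hsel : ∀ s : Finset ι, s.Nonempty → sel s ∈ s) (hτ : 0 ≤ τ)
    (hd : d ⊆ S) : step sel (restrictColumns S X) Y τ d ⊆ S := by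
  by_cases h : ∃ j ∈ dᶜ, τ < |stat (restrictColumns S X) Y d j|
  · rw [step, if_pos h]
    obtain ⟨j, hj, hlt⟩ := h
    have hj' : j ∉ d := by simpa using hj
    have hm := (mem_maximizers.1 (sel_mem_maximizers (X := restrictColumns S X) (Y := Y) hsel hj')).2
      j hj'
    refine Finset.insert_subset ?_ hd
    by_contra hS
    rw [stat_restrictColumns hd (sel _), if_neg hS, abs_zero] at hm
    linarith
  · rwa [step, if_neg h]

lemma iterate_step_restrictColumns_subset (hsel : ∀ s : Finset ι, s.Nonempty → sel s ∈ s)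
    (hτ : 0 ≤ τ) (i : ℕ) : (step sel (restrictColumns S X) Y τ)^[i] ∅ ⊆ S := by
  induction i with
  | zero => simp
  | succ i ih =>
    rw [Function.iterate_succ_apply']
    exact step_restrictColumns_subset hsel hτ ih

/-- As long as no column outside `S` exceeds the threshold, the algorithm does not see these
columns. -/
lemma step_restrictColumns (hτ : 0 ≤ τ) (hd : d ⊆ S) (h : ∀ j ∉ S, |stat X Y d j| ≤ τ) :
    step sel (restrictColumns S X) Y τ d = step sel X Y τ d := by
  have hst := fun j => stat_restrictColumns (X := X) (Y := Y) hd j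
  have hcond : (∃ j ∈ dᶜ, τ < |stat (restrictColumns S X) Y d j|) ↔
      ∃ j ∈ dᶜ, τ < |stat X Y d j| := by
    refine exists_congr fun j => and_congr_right fun _ => ?_
    rw [hst]
    split_ifs with hj
    · rfl
    · simpa [hτ.not_gt] using h j hj
  unfold step
  by_cases hc : ∃ j ∈ dᶜ, τ < |stat X Y d j|
  · rw [if_pos hc, if_pos (hcond.2 hc)]
    obtain ⟨m, hmd, hm⟩ := hc
    have hmd' : m ∉ d := by simpa using hmd
    have hmS : m ∈ S := by
      by_contra hS
      exact (h m hS).not_gt hm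
    congr 2
    ext j
    rw [mem_maximizers, mem_maximizers]
    refine and_congr_right fun hj => ⟨fun hmax l hl => ?_, fun hmax l hl => ?_⟩
    · have hjS : j ∈ S := by
        by_contra hS
        have := hmax m hmd'
        rw [hst, hst, if_pos hmS, if_neg hS, abs_zero] at this
        linarith
      have h1 := hmax l hl
      have h2 := hmax m hmd'
      rw [hst, hst, if_pos hjS] at h1 h2
      rw [if_pos hmS] at h2
      split_ifs at h1 with hlS
      · exact h1
      · exact (h l hlS).trans (hm.le.trans h2)
    · have hjS : j ∈ S := by
        by_contra hS
        have := hmax m hmd'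
        have := h j hS
        linarith
      rw [hst, hst, if_pos hjS]
      split_ifs
      · exact hmax l hl
      · simp
  · rw [if_neg hc, if_neg (mt hcond.1 hc)]

/-- If along the run on the columns in `S` no column outside `S` exceeds the threshold, the
algorithm stops inside `S`. The run on `S` is stationary after `S.card` steps, hence only the
first `S.card + 1` residuals matter. -/
lemma support_subset_and_stat_le (hsel : ∀ s : Finset ι, s.Nonempty → sel s ∈ s) (hτ : 0 ≤ τ)
    (h : ∀ i ≤ S.card, ∀ j ∉ S,
      |stat X Y ((step sel (restrictColumns S X) Y τ)^[i] ∅) j| ≤ τ) :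
    support sel X Y τ ⊆ S ∧
      ∀ j ∉ support sel X Y τ, |stat X Y (support sel X Y τ) j| ≤ τ := by
  obtain ⟨D, hD⟩ : ∃ D : ℕ → Finset ι, ∀ i, (step sel (restrictColumns S X) Y τ)^[i] ∅ = D i :=
    ⟨_, fun _ => rfl⟩
  simp only [hD] at h
  have hDS : ∀ i, D i ⊆ S := fun i => hD i ▸ iterate_step_restrictColumns_subset hsel hτ i
  have hstep : ∀ i ≤ S.card, step sel X Y τ (D i) = D (i + 1) := fun i hi => by
    rw [← step_restrictColumns hτ (hDS i) (h i hi), ← hD, ← hD,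
      Function.iterate_succ_apply']
  have hiter : ∀ i ≤ S.card, (step sel X Y τ)^[i] ∅ = D i := by
    intro i
    induction i with
    | zero => intro _; rw [← hD, Function.iterate_zero_apply, Function.iterate_zero_apply]
    | succ i ih =>
      intro hi
      rw [Function.iterate_succ_apply', ih (by omega), hstep i (by omega)]
  have hfix : step sel X Y τ (D S.card) = D S.card ∧
      ∀ j ∉ D S.card, |stat X Y (D S.card) j| ≤ τ := by
    rcases card_step (X := X) (Y := Y) (τ := τ) (d := D S.card) hsel with h1 | h1
    · exact h1
    exfalso
    rcases le_card_iterate_step (X := X) (Y := Y) (τ := τ) hsel S.card with h2 | h2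
    · rw [hiter _ le_rfl] at h2
      rw [h2] at h1
      omega
    · rw [hiter _ le_rfl] at h2
      rw [hstep _ le_rfl] at h1
      have := Finset.card_le_card (hDS (S.card + 1))
      omega
  have hsupp : support sel X Y τ = D S.card := by
    obtain ⟨m, hm⟩ := Nat.exists_eq_add_of_le' (Finset.card_le_univ S)
    rw [support, hm, Function.iterate_add_apply, hiter _ le_rfl]
    exact Function.iterate_fixed hfix.1 m
  rw [hsupp]
  exact ⟨hDS _, hfix.2⟩

end Restrict

/-! ### Analysis of the stopping rule -/

section Stopping

variable {n p : ℕ} {X : Matrix (Fin n) (Fin p) ℝ} {S d : Finset (Fin p)}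

lemma toLp_mulVec (X : Matrix (Fin n) (Fin p) ℝ) (b : Fin p → ℝ) :
    (WithLp.toLp 2 (X *ᵥ b) : EuclideanSpace ℝ (Fin n)) = ∑ j, b j • column X j := by
  ext i
  simp [column, Matrix.mulVec, dotProduct, mul_comm]

lemma response_eq (X : Matrix (Fin n) (Fin p) ℝ) (β : Fin p → ℝ) (ε : Fin n → ℝ) :
    response X β ε = ∑ j ∈ trueSupport β, β j • column X j + WithLp.toLp 2 ε := by
  rw [response, WithLp.toLp_add, toLp_mulVec]
  congr 1
  refine (Finset.sum_subset (Finset.subset_univ _) fun j _ hj => ?_).symm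
  have : β j = 0 := by simpa [trueSupport] using hj
  simp [this]

lemma response_restrictColumns (X : Matrix (Fin n) (Fin p) ℝ) (β : Fin p → ℝ) (ε : Fin n → ℝ) :
    response (restrictColumns (trueSupport β) X) β ε = response X β ε := by
  rw [response_eq, response_eq]
  congr 1
  exact Finset.sum_congr rfl fun j hj => by rw [column_restrictColumns_of_mem hj]

lemma Condition1.le_norm_sq {lamMin lamMax : ℝ} (h : Condition1 X S lamMin lamMax) (hn : 0 < n)
    (b : Fin p → ℝ) :
    lamMin * n * ∑ j ∈ S, b j ^ 2 ≤ ‖∑ j ∈ S, b j • column X j‖ ^ 2 := by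
  have h1 := (h (WithLp.toLp 2 fun j => b j)).2
  have hv : (WithLp.toLp 2 (X.submatrix id (Subtype.val : S → Fin p) *ᵥ fun j : S => b j) :
      EuclideanSpace ℝ (Fin n)) = ∑ j ∈ S, b j • column X j := by
    rw [← Finset.sum_coe_sort]
    ext i
    simp [column, Matrix.mulVec, dotProduct, mul_comm]
  have hn' : (0 : ℝ) < n := by exact_mod_cast hn
  rw [EuclideanSpace.real_norm_sq_eq] at h1
  simp only [hv] at h1
  rw [le_div_iff₀ hn', Finset.sum_coe_sort S (fun j => b j ^ 2)] at h1
  linarith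

lemma exists_residual_eq_sum (hd : d ⊆ S) (b : Fin p → ℝ) :
    ∃ b' : Fin p → ℝ, (∀ j ∉ d, b' j = b j) ∧
      residual X (∑ j ∈ S, b j • column X j) d = ∑ j ∈ S, b' j • column X j := by
  set v := ∑ j ∈ S, b j • column X j with hv
  obtain ⟨c, hc⟩ := (Submodule.mem_span_image_finset_iff_exists_fun' ℝ).1
    (sub_residual_mem_span X v d)
  refine ⟨fun j => b j - if j ∈ d then c j else 0, fun j hj => by simp [hj], ?_⟩
  simp only [sub_smul, Finset.sum_sub_distrib, ite_smul, zero_smul, Finset.sum_ite_mem,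
    Finset.inter_eq_right.2 hd]
  rw [hc, ← hv, sub_sub_cancel]

lemma column_eq_sum {j : Fin p} (hj : j ∈ S) :
    column X j = ∑ l ∈ S, (if l = j then (1 : ℝ) else 0) • column X l := by
  simp [hj]

lemma Condition1.le_norm_residual_erase_sq {lamMin lamMax : ℝ}
    (h : Condition1 X S lamMin lamMax) (hn : 0 < n) (hlam : 0 < lamMin) {j : Fin p} (hj : j ∈ S) :
    lamMin * n ≤ ‖residual X (column X j) (S.erase j)‖ ^ 2 := by
  obtain ⟨b, hb, hres⟩ := exists_residual_eq_sum (X := X) (S.erase_subset j)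
    (fun l => if l = j then (1 : ℝ) else 0)
  rw [← column_eq_sum hj] at hres
  rw [hres]
  refine le_trans ?_ (h.le_norm_sq hn b)
  have h1 : b j = 1 := by simpa using hb j (by simp)
  have h2 : 1 ≤ ∑ l ∈ S, b l ^ 2 := by
    calc (1 : ℝ) = b j ^ 2 := by rw [h1]; norm_num
      _ ≤ _ := Finset.single_le_sum (f := fun l => b l ^ 2) (fun l _ => sq_nonneg _) hj
  exact le_mul_of_one_le_right (by positivity) h2

/-- The least-squares coefficients of the noise on the columns in `S`. The `j`-th coefficient is
the coefficient of `ε` along the part of `X_j` that is orthogonal to the other columns, so the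
hypothesis on the noise makes it small. -/
lemma exists_leastSquares_coeff {lamMin lamMax : ℝ} (h : Condition1 X S lamMin lamMax) (hn : 0 < n)
    (hlam : 0 < lamMin) {c : ℝ} (ε : EuclideanSpace ℝ (Fin n))
    (hε : ∀ j ∈ S, |inner ℝ (residual X (column X j) (S.erase j)) ε| ≤
      c * ‖residual X (column X j) (S.erase j)‖) :
    ∃ η : Fin p → ℝ, ε = ∑ j ∈ S, η j • column X j + residual X ε S ∧
      ∀ j ∈ S, lamMin * n * η j ^ 2 ≤ c ^ 2 := by
  obtain ⟨η, hη⟩ := (Submodule.mem_span_image_finset_iff_exists_fun' ℝ).1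
    (sub_residual_mem_span X ε S)
  have hdec : ε = ∑ j ∈ S, η j • column X j + residual X ε S := by rw [hη, sub_add_cancel]
  refine ⟨η, hdec, fun j hj => ?_⟩
  set q := residual X (column X j) (S.erase j) with hq
  have hqn := h.le_norm_residual_erase_sq hn hlam hj
  rw [← hq] at hqn
  have hqpos : 0 < ‖q‖ ^ 2 := lt_of_lt_of_le (by positivity) hqn
  have hqmem : q ∈ Submodule.span ℝ (column X '' (S : Set (Fin p))) := by
    have h1 := sub_residual_mem_span X (column X j) (S.erase j)
    have h2 := Submodule.span_mono (R := ℝ) (Set.image_mono (f := column X)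
      (Finset.coe_subset.2 (S.erase_subset j))) h1
    have h3 : column X j ∈ Submodule.span ℝ (column X '' (S : Set (Fin p))) :=
      Submodule.subset_span ⟨j, hj, rfl⟩
    simpa [hq] using Submodule.sub_mem _ h3 h2
  have hqj : inner ℝ q (column X j) = ‖q‖ ^ 2 := by
    have := inner_residual_of_mem_span (Y := column X j)
      (sub_residual_mem_span X (column X j) (S.erase j))
    rw [← hq, inner_sub_left, real_inner_self_eq_norm_sq, real_inner_comm] at this
    linarith
  have hinner : inner ℝ q ε = η j * ‖q‖ ^ 2 := by
    rw [hdec, inner_add_right, inner_residual_of_mem_span hqmem, add_zero, inner_sum,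
      Finset.sum_eq_single_of_mem j hj, real_inner_smul_right, hqj]
    intro l hl hlj
    rw [real_inner_smul_right, real_inner_comm, hq,
      inner_column_residual (Finset.mem_erase.2 ⟨hlj, hl⟩), mul_zero]
  have h3 := hε j hj
  rw [← hq, hinner] at h3
  have h4 : (η j * ‖q‖ ^ 2) ^ 2 ≤ (c * ‖q‖) ^ 2 := sq_le_sq' (abs_le.1 h3).1 (abs_le.1 h3).2
  have h5 : η j ^ 2 * ‖q‖ ^ 2 ≤ c ^ 2 := by
    refine le_of_mul_le_mul_right ?_ hqpos
    linarith
  nlinarith [sq_nonneg (η j)]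

lemma abs_inner_le_of_abs_stat_le {Y : EuclideanSpace ℝ (Fin n)} {τ : ℝ} {j : Fin p}
    (h : |stat X Y d j| ≤ τ) : |inner ℝ (column X j) (residual X Y d)| ≤ τ * ‖residual X Y d‖ := by
  rcases eq_or_ne (residual X Y d) 0 with h0 | h0
  · simp [h0]
  · rwa [stat, abs_div, abs_norm, div_le_iff₀ (norm_pos_iff.2 h0)] at h

/-- If the algorithm stops at `d ⊆ S` for the response `Y = X_S b + e` with `e` orthogonal to the
columns in `S`, then the coefficients that are still missing are controlled by the norm of `e`. The quantity `A` is the squared norm of the part of the residual that lies in the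
span of the columns. -/
lemma exists_sq_norm_bound_of_stat_le {lamMin lamMax τ : ℝ} (h : Condition1 X S lamMin lamMax)
    (hn : 0 < n) (hlam : 0 < lamMin) (hd : d ⊆ S) (b : Fin p → ℝ)
    {e : EuclideanSpace ℝ (Fin n)} (he : ∀ j ∈ S, inner ℝ (column X j) e = 0)
    (hstat : ∀ j ∈ S \ d, |stat X (∑ j ∈ S, b j • column X j + e) d j| ≤ τ) :
    ∃ A : ℝ, 0 ≤ A ∧ lamMin * n * ∑ j ∈ S \ d, b j ^ 2 ≤ A ∧
      lamMin * n * A ≤ τ ^ 2 * (S \ d).card * (A + ‖e‖ ^ 2) := by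
  obtain ⟨b', hb', hw⟩ := exists_residual_eq_sum (X := X) hd b
  set w := residual X (∑ j ∈ S, b j • column X j) d with hwdef
  set B := ∑ j ∈ S \ d, b j ^ 2 with hB
  have hBn : 0 ≤ B := Finset.sum_nonneg fun _ _ => sq_nonneg _
  have hlow : lamMin * n * B ≤ ‖w‖ ^ 2 := by
    rw [hw]
    refine le_trans ?_ (h.le_norm_sq hn b')
    refine mul_le_mul_of_nonneg_left ?_ (by positivity)
    rw [hB, Finset.sum_congr rfl fun j hj => by rw [← hb' j (Finset.mem_sdiff.1 hj).2]]
    exact Finset.sum_le_sum_of_subset_of_nonneg Finset.sdiff_subset fun _ _ _ => sq_nonneg _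
  have hR : residual X (∑ j ∈ S, b j • column X j + e) d = w + e := by
    rw [residual_add, ← hwdef, residual_eq_self fun j hj => he j (hd hj)]
  have hwe : inner ℝ w e = 0 := by
    rw [hw, sum_inner]
    exact Finset.sum_eq_zero fun j hj => by rw [real_inner_smul_left, he j hj, mul_zero]
  have hRn : ‖w + e‖ ^ 2 = ‖w‖ ^ 2 + ‖e‖ ^ 2 := by
    rw [norm_add_sq_real, hwe]; ring
  refine ⟨‖w‖ ^ 2, sq_nonneg _, hlow, ?_⟩
  have hwsq : ‖w‖ ^ 2 = ∑ j ∈ S \ d, b j * inner ℝ (column X j) w := by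
    rw [← real_inner_self_eq_norm_sq]
    nth_rewrite 1 [hw]
    rw [sum_inner, ← Finset.sum_sdiff hd]
    rw [Finset.sum_eq_zero (s := d) fun j hj => by
      rw [real_inner_smul_left, inner_column_residual hj, mul_zero], add_zero]
    exact Finset.sum_congr rfl fun j hj => by
      rw [real_inner_smul_left, hb' j (Finset.mem_sdiff.1 hj).2]
  have hcol : ∀ j ∈ S \ d, |inner ℝ (column X j) w| ≤ τ * ‖w + e‖ := fun j hj => by
    have h1 := abs_inner_le_of_abs_stat_le (hstat j hj)
    rwa [hR, inner_add_right, he j (Finset.mem_sdiff.1 hj).1, add_zero] at h1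
  have hsum : ∑ j ∈ S \ d, inner ℝ (column X j) w ^ 2 ≤
      (S \ d).card * (τ ^ 2 * ‖w + e‖ ^ 2) := by
    rw [← nsmul_eq_mul]
    refine Finset.sum_le_card_nsmul _ _ _ fun j hj => ?_
    rw [← mul_pow, ← sq_abs]
    exact pow_le_pow_left₀ (abs_nonneg _) (hcol j hj) 2
  -- Cauchy–Schwarz for the expansion of `‖w‖ ^ 2`
  have hCS : (‖w‖ ^ 2) ^ 2 ≤ B * ((S \ d).card * (τ ^ 2 * ‖w + e‖ ^ 2)) := by
    rw [hwsq]
    exact (Finset.sum_mul_sq_le_sq_mul_sq _ _ _).trans (mul_le_mul_of_nonneg_left hsum hBn)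
  rw [hRn] at hCS
  rcases (sq_nonneg ‖w‖).eq_or_lt with h0 | h0
  · rw [← h0]; simp; positivity
  · refine le_of_mul_le_mul_right ?_ h0
    have hC : 0 ≤ (S \ d).card * (τ ^ 2 * (‖w‖ ^ 2 + ‖e‖ ^ 2)) := by positivity
    nlinarith [mul_le_mul_of_nonneg_right hlow hC,
      mul_le_mul_of_nonneg_left hCS (show (0 : ℝ) ≤ lamMin * n by positivity)]

lemma sum_sub_sq_le {ι : Type*} (s : Finset ι) (b η : ι → ℝ) {u v : ℝ} (hu : 0 ≤ u) (hv : 0 ≤ v)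
    (hb : ∑ j ∈ s, b j ^ 2 ≤ u ^ 2) (hη : ∑ j ∈ s, η j ^ 2 ≤ v ^ 2) :
    ∑ j ∈ s, (b j - η j) ^ 2 ≤ (u + v) ^ 2 := by
  have h1 : (∑ j ∈ s, b j * η j) ^ 2 ≤ (u * v) ^ 2 := by
    rw [mul_pow]
    exact (Finset.sum_mul_sq_le_sq_mul_sq _ _ _).trans
      (mul_le_mul hb hη (Finset.sum_nonneg fun _ _ => sq_nonneg _) (sq_nonneg _))
  have h2 := (abs_le_of_sq_le_sq' h1 (by positivity)).1
  have h3 : ∑ j ∈ s, (b j - η j) ^ 2 =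
      ∑ j ∈ s, b j ^ 2 + ∑ j ∈ s, η j ^ 2 - 2 * ∑ j ∈ s, b j * η j := by
    rw [Finset.mul_sum, ← Finset.sum_add_distrib, ← Finset.sum_sub_distrib]
    exact Finset.sum_congr rfl fun j _ => by ring
  rw [h3]
  nlinarith

lemma one_le_r₁_mul {lamMin lamMax lam : ℝ} (hlamMin : 0 < lamMin) (hlamMax : lamMin ≤ lamMax)
    (hle : lamMin ≤ 1) : 1 ≤ r₁ lamMin lamMax lam * lamMin := by
  have h1 : lamMin ≤ max lamMax lam := hlamMax.trans (le_max_left _ _)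
  rw [r₁, div_mul_eq_mul_div, one_le_div (by positivity)]
  nlinarith [mul_le_mul_of_nonneg_right h1 hlamMin.le, mul_le_mul_of_nonneg_left hle
    (sq_nonneg lamMin)]

lemma le_r₁_mul_sq {lamMin lamMax lam : ℝ} (hlamMin : 0 < lamMin) (hlam : 0 < lam)
    (hle : lamMin ≤ 1) : lam ≤ r₁ lamMin lamMax lam * lamMin ^ 2 := by
  have h1 : lam ≤ max lamMax lam := le_max_right _ _
  rw [r₁, div_mul_eq_mul_div, le_div_iff₀ (by positivity)]
  have h2 : lamMin ^ 3 ≤ lamMin ^ 2 := pow_le_pow_of_le_one hlamMin.le hle (by norm_num)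
  exact mul_le_mul h1 h2 (by positivity) (hlam.le.trans h1)

/-- The missed coefficients of `b` are bounded through the sample size. The first term in the
definition of `ξ` absorbs the part of the residual inside the span of the columns, at the price of a
factor `1 / (1 - x ^ 2) ≤ 1 / (1 - x) ^ 2`, where `x = 1 / √(1 + δ)`. -/
lemma mul_sq_le_of_bounds {lamMin lamMax lam N A B e m kbar τ σ δ x : ℝ}
    (hlamMin : 0 < lamMin) (hlamMax : lamMin ≤ lamMax) (hlam : 0 < lam) (hle : lamMin ≤ 1)
    (hN : 0 < N) (hB : 0 ≤ B) (hA : 0 ≤ A) (hm : 0 ≤ m) (hmk : m ≤ kbar) (hδ : 0 < δ)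
    (hx : 0 < x) (hx1 : x < 1) (hxδ : x ^ 2 * (1 + δ) = 1)
    (hsize : (1 + δ) * r₁ lamMin lamMax lam * kbar * τ ^ 2 ≤ N)
    (h1 : lamMin * N * B ≤ A) (h2 : lamMin * N * A ≤ τ ^ 2 * m * (A + e))
    (he : e ≤ N * (σ ^ 2 * lam)) :
    N * B * (1 - x) ^ 2 ≤ m * σ ^ 2 * τ ^ 2 * r₁ lamMin lamMax lam := by
  have hr1 := one_le_r₁_mul (lam := lam) hlamMin hlamMax hle
  have hr2 := le_r₁_mul_sq (lamMax := lamMax) hlamMin hlam hle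
  set r := r₁ lamMin lamMax lam
  have hr : 0 < r := by
    by_contra! h
    nlinarith
  have hτm : τ ^ 2 * m ≤ N * x ^ 2 * lamMin := by
    have h3 : r * (τ ^ 2 * m) ≤ N * x ^ 2 := by
      have h4 : (1 + δ) * r * (τ ^ 2 * m) ≤ N := by
        refine le_trans ?_ hsize
        have := mul_le_mul_of_nonneg_left hmk (show 0 ≤ (1 + δ) * r * τ ^ 2 by positivity)
        linarith
      have h5 := mul_le_mul_of_nonneg_right h4 (sq_nonneg x)
      calc r * (τ ^ 2 * m) = x ^ 2 * (1 + δ) * (r * (τ ^ 2 * m)) := by rw [hxδ, one_mul]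
        _ ≤ N * x ^ 2 := by linarith
    have h6 : 0 ≤ τ ^ 2 * m := by positivity
    nlinarith [mul_le_mul_of_nonneg_right hr1 h6, mul_le_mul_of_nonneg_right h3 hlamMin.le]
  have h7 : lamMin * N * A * (1 - x ^ 2) ≤ τ ^ 2 * m * (N * (σ ^ 2 * lam)) := by
    have h8 := mul_le_mul_of_nonneg_right hτm hA
    have h9 := mul_le_mul_of_nonneg_left he (show 0 ≤ τ ^ 2 * m by positivity)
    linarith
  have h10 : lamMin * A * (1 - x ^ 2) ≤ τ ^ 2 * m * (σ ^ 2 * lam) := by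
    refine le_of_mul_le_mul_right ?_ hN
    linarith
  have hx2 : 0 ≤ 1 - x ^ 2 := by nlinarith
  have h11 : lamMin ^ 2 * (N * B * (1 - x ^ 2)) ≤
      lamMin ^ 2 * (m * σ ^ 2 * τ ^ 2 * r) := by
    have h12 := mul_le_mul_of_nonneg_left h1 (show 0 ≤ lamMin * (1 - x ^ 2) by positivity)
    have h13 := mul_le_mul_of_nonneg_left hr2 (show 0 ≤ τ ^ 2 * m * σ ^ 2 by positivity)
    linarith
  refine le_trans ?_ (le_of_mul_le_mul_left h11 (by positivity))
  exact mul_le_mul_of_nonneg_left (by nlinarith) (by positivity)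

/-- If the algorithm stops at a subset `d` of the true support, and the least-squares coefficients
of the noise are below their threshold, the missed coefficients satisfy the asserted bound. -/
theorem sum_missed_sq_le {β : Fin p → ℝ} {ε : Fin n → ℝ}
    {lamMin lamMax lam σ α δ τ : ℝ} {kbar : ℕ}
    (hlamMin : 0 < lamMin) (hlamMax : lamMin ≤ lamMax) (hlam : 0 < lam) (hle : lamMin ≤ 1)
    (hα : 0 < α) (hδ : 0 < δ) (hk : (trueSupport β).card ≤ kbar)
    (hkbar : 1 ≤ kbar) (hn : 0 < n)
    (hsize : (n : ℝ) = ξ σ lamMin lamMax lam kbar α δ * kbar * τ ^ 2)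
    (h1 : Condition1 X (trueSupport β) lamMin lamMax) (h2 : Condition2 ε σ lam)
    (hε : ∀ j ∈ trueSupport β,
      |inner ℝ (residual X (column X j) ((trueSupport β).erase j)) (WithLp.toLp 2 ε)| ≤
        σ * τ * ‖residual X (column X j) ((trueSupport β).erase j)‖)
    (hd : d ⊆ trueSupport β)
    (hstat : ∀ j ∈ trueSupport β \ d, |stat X (response X β ε) d j| ≤ τ) :
    ∑ j ∈ trueSupport β \ d, β j ^ 2 ≤ α * (trueSupport β \ d).card := by
  set S := trueSupport β with hS
  set E : EuclideanSpace ℝ (Fin n) := WithLp.toLp 2 ε with hE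
  have hN : (0 : ℝ) < n := by exact_mod_cast hn
  have hkb : (0 : ℝ) < kbar := by exact_mod_cast hkbar
  obtain ⟨η, hdec, hη⟩ := exists_leastSquares_coeff h1 hn hlamMin E hε
  have hresp : response X β ε = ∑ j ∈ S, (β j + η j) • column X j + residual X E S := by
    rw [response_eq, ← hS, ← hE]
    nth_rewrite 1 [hdec]
    simp only [add_smul, Finset.sum_add_distrib]
    abel
  rw [hresp] at hstat
  obtain ⟨A, hA, hA1, hA2⟩ := exists_sq_norm_bound_of_stat_le h1 hn hlamMin hd
    (fun j => β j + η j) (fun j hj => inner_column_residual hj) hstat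
  have he : ‖residual X E S‖ ^ 2 ≤ n * (σ ^ 2 * lam) := by
    have h3 : ‖residual X E S‖ ≤ ‖E‖ := by
      rw [residual, ← Submodule.starProjection_orthogonal_val]
      exact Submodule.norm_starProjection_apply_le _ _
    have h4 : ‖E‖ ^ 2 / n ≤ σ ^ 2 * lam := h2
    rw [div_le_iff₀ hN] at h4
    nlinarith [norm_nonneg (residual X E S)]
  have hs : 1 < √(1 + δ) := by
    rw [Real.lt_sqrt (by norm_num)]; linarith
  obtain ⟨x, hxdef⟩ : ∃ x, x = 1 / √(1 + δ) := ⟨_, rfl⟩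
  have hx : 0 < x := by rw [hxdef]; positivity
  have hx1 : x < 1 := by rw [hxdef, div_lt_one (by positivity)]; exact hs
  have hxδ : x ^ 2 * (1 + δ) = 1 := by
    rw [hxdef, div_pow, Real.sq_sqrt (by positivity)]
    field_simp
  have hsize1 : (1 + δ) * r₁ lamMin lamMax lam * kbar * τ ^ 2 ≤ n := by
    rw [hsize]
    gcongr
    exact le_max_left _ _
  have hsize2 : σ ^ 2 * r₂ lamMin lamMax lam ^ 2 * f δ * τ ^ 2 ≤ α * n := by
    have h5 : σ ^ 2 * r₂ lamMin lamMax lam ^ 2 * f δ / (kbar * α) * kbar * τ ^ 2 ≤ n := by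
      rw [hsize]
      gcongr
      exact le_max_right _ _
    calc _ = α * (σ ^ 2 * r₂ lamMin lamMax lam ^ 2 * f δ / (kbar * α) * kbar * τ ^ 2) := by
          field_simp
      _ ≤ _ := by gcongr
  obtain ⟨m, hm⟩ : ∃ m : ℝ, ((S \ d).card : ℝ) = m := ⟨_, rfl⟩
  rw [hm] at hA2 ⊢
  have hm0 : 0 ≤ m := hm ▸ Nat.cast_nonneg _
  have hmk : m ≤ kbar :=
    hm ▸ Nat.cast_le.2 ((Finset.card_le_card Finset.sdiff_subset).trans hk)
  have hb := mul_sq_le_of_bounds hlamMin hlamMax hlam hle hN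
    (Finset.sum_nonneg fun j _ => sq_nonneg (β j + η j)) hA hm0 hmk hδ hx hx1 hxδ hsize1 hA1 hA2 he
  have hr : 0 ≤ r₁ lamMin lamMax lam := by
    have := one_le_r₁_mul (lam := lam) hlamMin hlamMax hle
    by_contra! h
    nlinarith
  obtain ⟨g, hg, hg2⟩ : ∃ g : ℝ, 0 ≤ g ∧ g ^ 2 = m * (σ * τ) ^ 2 / n :=
    ⟨√(m * (σ * τ) ^ 2 / n), Real.sqrt_nonneg _, Real.sq_sqrt (by positivity)⟩
  have hx' : 0 < 1 - x := by linarith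
  have hu : ∑ j ∈ S \ d, (β j + η j) ^ 2 ≤ (g * √(r₁ lamMin lamMax lam) / (1 - x)) ^ 2 := by
    rw [div_pow, mul_pow, Real.sq_sqrt hr, hg2, le_div_iff₀ (by positivity), div_mul_eq_mul_div,
      le_div_iff₀ hN]
    linarith
  have hv : ∑ j ∈ S \ d, η j ^ 2 ≤ (g * (1 / √lamMin)) ^ 2 := by
    rw [mul_pow, div_pow, Real.sq_sqrt hlamMin.le, hg2, one_pow, div_mul_div_comm, mul_one,
      le_div_iff₀ (by positivity), Finset.sum_mul, ← hm, ← nsmul_eq_mul (_ : ℕ) ((σ * τ) ^ 2)]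
    refine Finset.sum_le_card_nsmul _ _ _ fun j hj => ?_
    have := hη j (Finset.mem_sdiff.1 hj).1
    linarith
  have hfin := sum_sub_sq_le _ _ _ (by positivity) (by positivity) hu hv
  simp only [add_sub_cancel_right] at hfin
  refine hfin.trans ?_
  calc (g * √(r₁ lamMin lamMax lam) / (1 - x) + g * (1 / √lamMin)) ^ 2
      ≤ (g * √(r₁ lamMin lamMax lam) / (1 - x) + g * (1 / √lamMin) / (1 - x)) ^ 2 := by
        gcongr
        exact le_div_self (by positivity) hx' (by linarith)
    _ = g ^ 2 * r₂ lamMin lamMax lam ^ 2 * f δ := by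
        rw [r₂, f, ← hxdef]; field_simp; ring
    _ = m * (σ ^ 2 * r₂ lamMin lamMax lam ^ 2 * f δ * τ ^ 2) / n := by
        rw [hg2]; ring
    _ ≤ m * (α * n) / n := by gcongr
    _ = α * m := by field_simp

end Stopping

/-! ### Tail bounds -/

section Tails

open scoped ENNReal

variable {Ω : Type*} [MeasurableSpace Ω] {μ : Measure Ω}

lemma hasSubgaussianMGF_mono {Z : Ω → ℝ} {c c' : ℝ≥0} (h : HasSubgaussianMGF Z c μ) (hc : c ≤ c') :
    HasSubgaussianMGF Z c' μ where
  integrable_exp_mul := h.integrable_exp_mul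
  mgf_le t := (h.mgf_le t).trans (Real.exp_le_exp.2 (by gcongr))

lemma measure_abs_gt_le [IsProbabilityMeasure μ] {Z : Ω → ℝ} {c : ℝ≥0}
    (h : HasSubgaussianMGF Z c μ) {t : ℝ} (ht : 0 ≤ t) :
    μ {ω | t < |Z ω|} ≤ ENNReal.ofReal (2 * Real.exp (-t ^ 2 / (2 * c))) := by
  rw [← ofReal_measureReal]
  refine ENNReal.ofReal_le_ofReal ?_
  have hsub : {ω | t < |Z ω|} ⊆ {ω | t ≤ Z ω} ∪ {ω | t ≤ (-Z) ω} := fun ω hω => by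
    rcases lt_abs.1 (show t < |Z ω| from hω) with h | h
    · exact Or.inl h.le
    · exact Or.inr h.le
  calc μ.real {ω | t < |Z ω|} ≤ μ.real {ω | t ≤ Z ω} + μ.real {ω | t ≤ (-Z) ω} :=
        (measureReal_mono hsub).trans (measureReal_union_le _ _)
    _ ≤ _ := by linarith [h.measure_ge_le ht, h.neg.measure_ge_le ht]

lemma measure_abs_inner_gt_le {n : ℕ} {Z : Fin n → Ω → ℝ} {c : ℝ≥0} (hind : iIndepFun Z μ)
    (hsub : ∀ i, HasSubgaussianMGF (Z i) c μ) {u : EuclideanSpace ℝ (Fin n)} (hu : ‖u‖ ≤ 1) {t : ℝ}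
    (ht : 0 ≤ t) :
    μ {ω | t < |inner ℝ (WithLp.toLp 2 fun i => Z i ω) u|} ≤
      ENNReal.ofReal (2 * Real.exp (-t ^ 2 / (2 * c))) := by
  have := hind.isProbabilityMeasure
  have hind' : iIndepFun (fun i ω => u i * Z i ω) μ :=
    hind.comp (fun i x => u i * x) fun i => measurable_const.mul measurable_id
  have h1 := HasSubgaussianMGF.sum_of_iIndepFun (s := Finset.univ) hind'
    fun i _ => hasSubgaussianMGF_mono (c' := ‖u i‖₊ ^ 2 * c) ((hsub i).const_mul (u i))
      (le_of_eq (NNReal.eq (by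
        change u i ^ 2 * (c : ℝ) = _
        simp)))
  have h2 := measure_abs_gt_le (c := c) (hasSubgaussianMGF_mono h1 (by
    rw [← Finset.sum_mul]
    refine mul_le_of_le_one_left zero_le ?_
    rw [← NNReal.coe_le_coe]
    push_cast
    calc ∑ i, ‖u i‖ ^ 2 = ‖u‖ ^ 2 := (EuclideanSpace.norm_sq_eq u).symm
      _ ≤ 1 := pow_le_one₀ (norm_nonneg _) hu)) ht
  simpa [PiLp.inner_apply] using h2

/-- A bound on the sections of an event carries over to the event, by Fubini. -/
lemma measure_mem_le_of_indepFun [IsProbabilityMeasure μ] {A B : Type*} [MeasurableSpace A]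
    [MeasurableSpace B] {U : Ω → A} {V : Ω → B} (hU : Measurable U) (hV : Measurable V)
    (hind : IndepFun U V μ) {s : Set (A × B)} (hs : MeasurableSet s) {c : ℝ≥0∞}
    (h : ∀ v, μ {ω | (U ω, v) ∈ s} ≤ c) : μ {ω | (U ω, V ω) ∈ s} ≤ c := by
  have := Measure.isProbabilityMeasure_map (μ := μ) hU.aemeasurable
  have := Measure.isProbabilityMeasure_map (μ := μ) hV.aemeasurable
  calc μ {ω | (U ω, V ω) ∈ s} = μ.map (fun ω => (U ω, V ω)) s :=
        (Measure.map_apply (hU.prodMk hV) hs).symm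
    _ = ∫⁻ v, μ.map U ((fun u => (u, v)) ⁻¹' s) ∂(μ.map V) := by
        rw [(indepFun_iff_map_prod_eq_prod_map_map hU.aemeasurable hV.aemeasurable).1 hind,
          Measure.prod_apply_symm hs]
    _ ≤ ∫⁻ _, c ∂(μ.map V) := by
        refine lintegral_mono fun v => ?_
        rw [Measure.map_apply hU (measurable_prodMk_right hs)]
        exact h v
    _ = c := by simp

lemma measurableSet_lt_abs_inner {T : Type*} [MeasurableSpace T] {n : ℕ}
    {z u : T → EuclideanSpace ℝ (Fin n)} (hz : Measurable z) (hu : Measurable u) (t : ℝ) :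
    MeasurableSet {ω | t < |inner ℝ (z ω) (u ω)|} :=
  measurableSet_lt measurable_const (hz.inner hu).abs

lemma norm_inv_norm_smul_le {E : Type*} [NormedAddCommGroup E] [NormedSpace ℝ E] (v : E) :
    ‖‖v‖⁻¹ • v‖ ≤ 1 := by
  rw [norm_smul, norm_inv, norm_norm]
  exact inv_mul_le_one

end Tails

/-! ### Control of the noise and of the null columns -/

section Model

variable {Ω : Type*} [MeasurableSpace Ω] {μ : Measure Ω}
  {n p : ℕ} {X : Ω → Matrix (Fin n) (Fin p) ℝ} {ε : Ω → Fin n → ℝ}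

lemma indepFun_column
    (hX_meas : ∀ i j, Measurable fun ω => X ω i j)
    (hX_indep : iIndepFun (fun (q : Fin n × Fin p) ω => X ω q.1 q.2) μ)
    {S : Finset (Fin p)} {j : Fin p} (hj : j ∉ S) :
    IndepFun (fun ω i => X ω i j) (fun ω (q : Fin n × S) => X ω q.1 q.2) μ := by
  have hdisj : Disjoint ((Finset.univ : Finset (Fin n)) ×ˢ ({j} : Finset (Fin p)))
      ((Finset.univ : Finset (Fin n)) ×ˢ S) :=
    Finset.disjoint_product.2 (Or.inr (Finset.disjoint_singleton_left.2 hj))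
  have hmem1 : ∀ i : Fin n, (i, j) ∈ (Finset.univ : Finset (Fin n)) ×ˢ ({j} : Finset (Fin p)) :=
    fun i => Finset.mk_mem_product (Finset.mem_univ i) (Finset.mem_singleton_self j)
  have hmem2 : ∀ q : Fin n × S, (q.1, (q.2 : Fin p)) ∈ (Finset.univ : Finset (Fin n)) ×ˢ S :=
    fun q => Finset.mk_mem_product (Finset.mem_univ q.1) q.2.2
  have h1 := hX_indep.indepFun_finset _ _ hdisj fun q => hX_meas q.1 q.2
  exact h1.comp
    (measurable_pi_lambda (fun x i => x ⟨(i, j), hmem1 i⟩) fun i => measurable_pi_apply _)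
    (measurable_pi_lambda (fun x q => x ⟨(q.1, q.2), hmem2 q⟩) fun q => measurable_pi_apply _)

variable [IsProbabilityMeasure μ]

/-- The least-squares coefficient of the noise on `X_j` rarely exceeds its threshold, since the
noise is independent of the direction on which it is projected. -/
lemma measure_noise_gt_le {σ : ℝ≥0} (hσ : 0 < σ)
    (hX_meas : ∀ i j, Measurable fun ω => X ω i j)
    (hε_meas : ∀ i, Measurable fun ω => ε ω i)
    (hε_indep : iIndepFun (fun i ω => ε ω i) μ)
    (hε_sub : ∀ i, HasSubgaussianMGF (fun ω => ε ω i) (σ ^ 2) μ)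
    (hXε : IndepFun (fun ω (q : Fin n × Fin p) => X ω q.1 q.2) ε μ)
    {τ : ℝ} (hτ : 0 ≤ τ) (d : Finset (Fin p)) (j : Fin p) :
    μ {ω | ¬ |inner ℝ (residual (X ω) (column (X ω) j) d) (WithLp.toLp 2 (ε ω))| ≤
      σ * τ * ‖residual (X ω) (column (X ω) j) d‖} ≤
      ENNReal.ofReal (2 * Real.exp (-τ ^ 2 / 2)) := by
  let M : (Fin n × Fin p → ℝ) → Matrix (Fin n) (Fin p) ℝ := fun x => Matrix.of fun i l => x (i, l)
  have hM : ∀ i l, Measurable fun x => M x i l := fun i l => measurable_pi_apply (i, l)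
  let q : (Fin n × Fin p → ℝ) → EuclideanSpace ℝ (Fin n) :=
    fun x => residual (M x) (column (M x) j) d
  have hq : Measurable q := measurable_residual hM (measurable_column hM j) d
  have hs : MeasurableSet {y : (Fin n → ℝ) × (Fin n × Fin p → ℝ) |
      σ * τ < |inner ℝ (WithLp.toLp 2 y.1 : EuclideanSpace ℝ (Fin n)) (‖q y.2‖⁻¹ • q y.2)|} :=
    measurableSet_lt_abs_inner ((WithLp.measurable_toLp 2 _).comp measurable_fst)
      ((hq.norm.inv.smul hq).comp measurable_snd) _
  have h := measure_mem_le_of_indepFun (measurable_pi_lambda _ hε_meas)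
    (measurable_pi_lambda _ fun q => hX_meas q.1 q.2) hXε.symm hs fun x =>
      measure_abs_inner_gt_le hε_indep hε_sub (norm_inv_norm_smul_le (q x))
        (t := σ * τ) (by positivity)
  have hexp : -((σ : ℝ) * τ) ^ 2 / (2 * ((σ ^ 2 : ℝ≥0) : ℝ)) = -τ ^ 2 / 2 := by
    have : (σ : ℝ) ≠ 0 := by exact_mod_cast hσ.ne'
    push_cast
    field_simp
  rw [hexp] at h
  refine (measure_mono fun ω hω => ?_).trans h
  have hMX : M (fun q => X ω q.1 q.2) = X ω := rfl
  simp only [Set.mem_ofPred_eq, q, hMX] at hω ⊢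
  rw [not_le] at hω
  set v := residual (X ω) (column (X ω) j) d
  have hv : 0 < ‖v‖ := by
    rw [norm_pos_iff]
    rintro h0
    simp [h0] at hω
  rw [real_inner_smul_right, abs_mul, abs_inv, abs_norm, real_inner_comm,
    inv_mul_eq_div, lt_div_iff₀ hv]
  exact hω

/-- A column outside `S` is rarely correlated with a direction that is a function of the columns in
`S` and the noise. -/
lemma measure_null_gt_le
    (hX_meas : ∀ i j, Measurable fun ω => X ω i j)
    (hX_indep : iIndepFun (fun (q : Fin n × Fin p) ω => X ω q.1 q.2) μ)
    (hX_sub : ∀ i j, HasSubgaussianMGF (fun ω => X ω i j) 1 μ)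
    (hε_meas : ∀ i, Measurable fun ω => ε ω i)
    (hXε : IndepFun (fun ω (q : Fin n × Fin p) => X ω q.1 q.2) ε μ)
    {τ : ℝ} (hτ : 0 ≤ τ) {S : Finset (Fin p)} {j : Fin p} (hj : j ∉ S)
    {g : ((Fin n × S) → ℝ) × (Fin n → ℝ) → EuclideanSpace ℝ (Fin n)} (hg : Measurable g)
    (hg1 : ∀ y, ‖g y‖ ≤ 1) :
    μ {ω | τ < |inner ℝ (column (X ω) j) (g (fun q => X ω q.1 q.2, ε ω))|} ≤
      ENNReal.ofReal (2 * Real.exp (-τ ^ 2 / 2)) := by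
  have hs : MeasurableSet {y : (Fin n × Fin p → ℝ) × (Fin n → ℝ) |
      τ < |inner ℝ (WithLp.toLp 2 fun i => y.1 (i, j))
        (g ((fun q => y.1 (q.1, q.2) : Fin n × S → ℝ), y.2))|} := by
    refine measurableSet_lt_abs_inner ((WithLp.measurable_toLp 2 _).comp
      (measurable_pi_lambda _ fun i => (measurable_pi_apply (i, j)).comp measurable_fst))
      (hg.comp (Measurable.prodMk (measurable_pi_lambda _ fun q => ?_) measurable_snd)) τ
    exact (measurable_pi_apply ((q.1, q.2) : Fin n × Fin p)).comp measurable_fst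
  have hs' : ∀ e : Fin n → ℝ, MeasurableSet {y : (Fin n → ℝ) × (Fin n × S → ℝ) |
      τ < |inner ℝ (WithLp.toLp 2 y.1) (g (y.2, e))|} := fun e =>
    measurableSet_lt_abs_inner ((WithLp.measurable_toLp 2 _).comp measurable_fst)
      (hg.comp (measurable_snd.prodMk measurable_const)) τ
  have hcol : ∀ u : EuclideanSpace ℝ (Fin n), ‖u‖ ≤ 1 →
      μ {ω | τ < |inner ℝ (WithLp.toLp 2 fun i => X ω i j) u|} ≤
        ENNReal.ofReal (2 * Real.exp (-τ ^ 2 / 2)) := fun u hu => by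
    have h2 := measure_abs_inner_gt_le (Z := fun i ω => X ω i j) (c := 1)
      (hX_indep.precomp (g := fun i : Fin n => (i, j)) fun _ _ h => (Prod.ext_iff.1 h).1)
      (fun i => hX_sub i j) hu hτ
    rwa [NNReal.coe_one, mul_one] at h2
  have hX1 : Measurable fun ω (q : Fin n × Fin p) => X ω q.1 q.2 :=
    measurable_pi_lambda _ fun q => hX_meas q.1 q.2
  have hX2 : Measurable fun ω (q : Fin n × S) => X ω q.1 q.2 :=
    measurable_pi_lambda _ fun q => hX_meas q.1 q.2
  have hX3 : Measurable fun ω i => X ω i j := measurable_pi_lambda _ fun i => hX_meas i j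
  have hsec : ∀ e : Fin n → ℝ, μ {ω | τ < |inner ℝ (WithLp.toLp 2 fun i => X ω i j)
      (g ((fun q => X ω q.1 q.2 : Fin n × S → ℝ), e))|} ≤
        ENNReal.ofReal (2 * Real.exp (-τ ^ 2 / 2)) := fun e =>
    measure_mem_le_of_indepFun hX3 hX2 (indepFun_column hX_meas hX_indep hj) (hs' e)
      fun x => hcol (g (x, e)) (hg1 _)
  exact measure_mem_le_of_indepFun hX1 (measurable_pi_lambda _ hε_meas) hXε hs hsec

/-- The `i`-th residual of the run on the columns in `S` is a function of these columns and the noise: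
the response does not involve the other columns either. -/
lemma measure_stat_gt_le
    (hX_meas : ∀ i j, Measurable fun ω => X ω i j)
    (hX_indep : iIndepFun (fun (q : Fin n × Fin p) ω => X ω q.1 q.2) μ)
    (hX_sub : ∀ i j, HasSubgaussianMGF (fun ω => X ω i j) 1 μ)
    (hε_meas : ∀ i, Measurable fun ω => ε ω i)
    (hXε : IndepFun (fun ω (q : Fin n × Fin p) => X ω q.1 q.2) ε μ)
    {sel : Finset (Fin p) → Fin p} (hsel : ∀ s : Finset (Fin p), s.Nonempty → sel s ∈ s)
    {τ : ℝ} (hτ : 0 ≤ τ) (β : Fin p → ℝ) {j : Fin p} (hj : j ∉ trueSupport β) (i : ℕ) :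
    μ {ω | ¬ |stat (X ω) (response (X ω) β (ε ω)) ((step sel (restrictColumns (trueSupport β) (X ω))
      (response (X ω) β (ε ω)) τ)^[i] ∅) j| ≤ τ} ≤
      ENNReal.ofReal (2 * Real.exp (-τ ^ 2 / 2)) := by
  obtain ⟨S, hS⟩ : ∃ S, S = trueSupport β := ⟨_, rfl⟩
  rw [← hS] at hj ⊢
  -- the restricted design matrix, as a function of the entries of the columns in `S`
  let M : ((Fin n × S) → ℝ) → Matrix (Fin n) (Fin p) ℝ :=
    fun x => Matrix.of fun i l => if h : l ∈ S then x (i, ⟨l, h⟩) else 0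
  have hM : ∀ i l, Measurable fun y : ((Fin n × S) → ℝ) × (Fin n → ℝ) => M y.1 i l := fun i l => by
    by_cases h : l ∈ S
    · simp only [M, Matrix.of_apply, h, dif_pos]; fun_prop
    · simp only [M, Matrix.of_apply, h, dif_neg, not_false_eq_true]; fun_prop
  let Y : ((Fin n × S) → ℝ) × (Fin n → ℝ) → EuclideanSpace ℝ (Fin n) :=
    fun y => response (M y.1) β y.2
  have hY : Measurable Y := by
    simp only [Y, response_eq]
    exact (Finset.measurable_fun_sum _ fun j _ => (measurable_column hM j).const_smul (β j)).add
      ((WithLp.measurable_toLp 2 _).comp measurable_snd)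
  let R : ((Fin n × S) → ℝ) × (Fin n → ℝ) → EuclideanSpace ℝ (Fin n) :=
    fun y => residual (M y.1) (Y y) ((step sel (M y.1) (Y y) τ)^[i] ∅)
  have hR : Measurable R := measurable_residual_iterate_step sel hM hY τ i
  have h := measure_null_gt_le hX_meas hX_indep hX_sub hε_meas hXε hτ hj
    (g := fun y => ‖R y‖⁻¹ • R y) (hR.norm.inv.smul hR) fun y => norm_inv_norm_smul_le (R y)
  refine (measure_mono fun ω hω => ?_).trans h
  have hMX : M (fun q => X ω q.1 q.2) = restrictColumns S (X ω) := by
    ext i l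
    simp [M, restrictColumns]
  have hresp : response (restrictColumns S (X ω)) β (ε ω) = response (X ω) β (ε ω) := by
    rw [hS, response_restrictColumns]
  simp only [Set.mem_ofPred_eq, not_le] at hω ⊢
  simp only [R, Y, hMX, hresp]
  rw [residual_restrictColumns (iterate_step_restrictColumns_subset hsel hτ i),
    real_inner_smul_right, inv_mul_eq_div]
  exact hω

end Model

/-! ### Union bounds -/

lemma threshold_sq {a : ℝ} {p : ℕ} (ha : 0 ≤ a) : threshold a p ^ 2 = 2 * (1 + a) * Real.log p := by
  have := Real.log_natCast_nonneg p
  exact Real.sq_sqrt (by positivity)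

lemma exp_neg_threshold_sq {a : ℝ} {p : ℕ} (ha : 0 ≤ a) (hp : 0 < p) :
    Real.exp (-threshold a p ^ 2 / 2) = 1 / (p : ℝ) ^ (1 + a) := by
  have hp' : (0 : ℝ) < p := by exact_mod_cast hp
  rw [threshold_sq ha, Real.rpow_def_of_pos hp', one_div, ← Real.exp_neg]
  congr 1
  ring

lemma Perr_nonneg {pc : ℝ} (hpc : 0 ≤ pc) (a : ℝ) (p k : ℕ) : 0 ≤ Perr pc a p k := by
  unfold Perr
  split_ifs <;> positivity

/-- The sets need not be measurable: outer measure is subadditive. -/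
lemma one_sub_measureReal_compl_le {Ω : Type*} [MeasurableSpace Ω] {μ : Measure Ω}
    [IsProbabilityMeasure μ] {s t : Set Ω} (h : tᶜ ⊆ s) : 1 - μ.real s ≤ μ.real t := by
  have h1 : (1 : ℝ) ≤ μ.real (s ∪ t) := by
    rw [← probReal_univ (μ := μ)]
    refine measureReal_mono fun ω _ => ?_
    by_cases hω : ω ∈ t
    · exact Or.inr hω
    · exact Or.inl (h hω)
  linarith [measureReal_union_le (μ := μ) s t]

section Model

variable {Ω : Type*} [MeasurableSpace Ω] {μ : Measure Ω} [IsProbabilityMeasure μ]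
  {n p : ℕ} {X : Ω → Matrix (Fin n) (Fin p) ℝ} {ε : Ω → Fin n → ℝ}

lemma measureReal_noise_le {σ : ℝ≥0} (hσ : 0 < σ)
    (hX_meas : ∀ i j, Measurable fun ω => X ω i j)
    (hε_meas : ∀ i, Measurable fun ω => ε ω i)
    (hε_indep : iIndepFun (fun i ω => ε ω i) μ)
    (hε_sub : ∀ i, HasSubgaussianMGF (fun ω => ε ω i) (σ ^ 2) μ)
    (hXε : IndepFun (fun ω (q : Fin n × Fin p) => X ω q.1 q.2) ε μ)
    {a : ℝ} (ha : 0 ≤ a) (hp : 0 < p) (S : Finset (Fin p)) :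
    μ.real {ω | ¬ ∀ j ∈ S,
      |inner ℝ (residual (X ω) (column (X ω) j) (S.erase j)) (WithLp.toLp 2 (ε ω))| ≤
        σ * threshold a p * ‖residual (X ω) (column (X ω) j) (S.erase j)‖} ≤
      2 * S.card / (p : ℝ) ^ (1 + a) := by
  have hsub : {ω | ¬ ∀ j ∈ S,
      |inner ℝ (residual (X ω) (column (X ω) j) (S.erase j)) (WithLp.toLp 2 (ε ω))| ≤
        σ * threshold a p * ‖residual (X ω) (column (X ω) j) (S.erase j)‖} ⊆ ⋃ j ∈ S,
      {ω | ¬ |inner ℝ (residual (X ω) (column (X ω) j) (S.erase j)) (WithLp.toLp 2 (ε ω))| ≤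
        σ * threshold a p * ‖residual (X ω) (column (X ω) j) (S.erase j)‖} := fun ω hω => by
    obtain ⟨j, hj, hlt⟩ := not_forall₂.1 (show ¬ ∀ j ∈ S, _ from hω)
    exact Set.mem_biUnion hj hlt
  refine (measureReal_mono hsub (measure_ne_top _ _)).trans ((measureReal_biUnion_finset_le _ _).trans ?_)
  refine (Finset.sum_le_card_nsmul S _ (2 * (1 / (p : ℝ) ^ (1 + a))) fun j _ => ?_).trans_eq ?_
  · rw [← exp_neg_threshold_sq ha hp]
    exact ENNReal.toReal_le_of_le_ofReal (by positivity)
      (measure_noise_gt_le hσ hX_meas hε_meas hε_indep hε_sub hXε (Real.sqrt_nonneg _) _ j)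
  · rw [nsmul_eq_mul]; ring

lemma measureReal_false_positive_le
    (hX_meas : ∀ i j, Measurable fun ω => X ω i j)
    (hX_indep : iIndepFun (fun (q : Fin n × Fin p) ω => X ω q.1 q.2) μ)
    (hX_sub : ∀ i j, HasSubgaussianMGF (fun ω => X ω i j) 1 μ)
    (hε_meas : ∀ i, Measurable fun ω => ε ω i)
    (hXε : IndepFun (fun ω (q : Fin n × Fin p) => X ω q.1 q.2) ε μ)
    {sel : Finset (Fin p) → Fin p} (hsel : ∀ s : Finset (Fin p), s.Nonempty → sel s ∈ s)
    {a : ℝ} (ha : 0 ≤ a) (hp : 0 < p) (β : Fin p → ℝ) :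
    μ.real {ω | ¬ (support sel (X ω) (response (X ω) β (ε ω)) (threshold a p) ⊆ trueSupport β ∧
      ∀ j ∉ support sel (X ω) (response (X ω) β (ε ω)) (threshold a p),
        |stat (X ω) (response (X ω) β (ε ω))
          (support sel (X ω) (response (X ω) β (ε ω)) (threshold a p)) j| ≤ threshold a p)} ≤
      2 * ((trueSupport β).card + 1) / (p : ℝ) ^ a := by
  have hτ : 0 ≤ threshold a p := Real.sqrt_nonneg _
  have hp' : (0 : ℝ) < p := by exact_mod_cast hp
  let N : ℕ → Fin p → Set Ω := fun i j => {ω | ¬ |stat (X ω) (response (X ω) β (ε ω))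
    ((step sel (restrictColumns (trueSupport β) (X ω)) (response (X ω) β (ε ω))
      (threshold a p))^[i] ∅) j| ≤ threshold a p}
  have hN : ∀ i, ∀ j ∈ (trueSupport β)ᶜ, μ.real (N i j) ≤ 2 * (1 / (p : ℝ) ^ (1 + a)) := by
    intro i j hj
    rw [← exp_neg_threshold_sq ha hp]
    exact ENNReal.toReal_le_of_le_ofReal (by positivity) (measure_stat_gt_le hX_meas hX_indep
      hX_sub hε_meas hXε hsel hτ β (Finset.mem_compl.1 hj) i)
  have hNi : ∀ i, μ.real (⋃ j ∈ (trueSupport β)ᶜ, N i j) ≤ 2 / (p : ℝ) ^ a := fun i =>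
    calc μ.real (⋃ j ∈ (trueSupport β)ᶜ, N i j)
        ≤ ∑ j ∈ (trueSupport β)ᶜ, μ.real (N i j) := measureReal_biUnion_finset_le _ _
      _ ≤ (trueSupport β)ᶜ.card • (2 * (1 / (p : ℝ) ^ (1 + a))) :=
          Finset.sum_le_card_nsmul _ _ _ (hN i)
      _ ≤ p * (2 * (1 / (p : ℝ) ^ (1 + a))) := by
          rw [nsmul_eq_mul]
          gcongr
          simpa using Finset.card_le_univ (trueSupport β)ᶜ
      _ = 2 / (p : ℝ) ^ a := by
          rw [Real.rpow_add hp', Real.rpow_one]; field_simp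
  refine (measureReal_mono (s₂ := ⋃ i ∈ Finset.range ((trueSupport β).card + 1),
    ⋃ j ∈ (trueSupport β)ᶜ, N i j) (fun ω hω => ?_) (measure_ne_top _ _)).trans
      ((measureReal_biUnion_finset_le _ _).trans
        ((Finset.sum_le_card_nsmul _ _ _ fun i _ => hNi i).trans_eq ?_))
  · by_contra hmem
    refine hω (support_subset_and_stat_le hsel hτ fun i hi j hj => ?_)
    by_contra hlt
    exact hmem (Set.mem_biUnion (Finset.mem_coe.2 (Finset.mem_range_succ_iff.2 hi))
      (Set.mem_biUnion (Finset.mem_coe.2 (Finset.mem_compl.2 hj)) hlt))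
  · rw [nsmul_eq_mul, Finset.card_range]; push_cast; ring

end Model

/-- A missed index would contribute more than `α`, so under the bound on the missed coefficients
there is none. -/
lemma eq_trueSupport_of_sum_missed_le {p : ℕ} {β : Fin p → ℝ} {d : Finset (Fin p)} {α b : ℝ}
    (hb0 : 0 < b) (hb : ∀ j ∈ trueSupport β, b ≤ |β j|) (hα : α < b ^ 2) (hd : d ⊆ trueSupport β)
    (h : ∑ j ∈ trueSupport β \ d, β j ^ 2 ≤ α * (trueSupport β \ d).card) :
    d = trueSupport β := by
  by_contra hne
  have hnon : (trueSupport β \ d).Nonempty :=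
    Finset.sdiff_nonempty.2 fun hle => hne (Finset.Subset.antisymm hd hle)
  refine h.not_gt ?_
  rw [mul_comm, ← nsmul_eq_mul, ← Finset.sum_const]
  refine Finset.sum_lt_sum_of_nonempty hnon fun j hj => hα.trans_le ?_
  rw [← sq_abs (β j)]
  exact pow_le_pow_left₀ hb0.le (hb j (Finset.mem_sdiff.1 hj).1) 2

end OMP

/-! ### The recovery theorem -/

theorem mainTheorem2 {Ω : Type*} [MeasurableSpace Ω] (μ : Measure Ω) [IsProbabilityMeasure μ]
    {n p : ℕ} (X : Ω → Matrix (Fin n) (Fin p) ℝ) (ε : Ω → Fin n → ℝ) (β : Fin p → ℝ)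
    (σ : ℝ≥0) (hσ : 0 < σ)
    -- the entries of `X` are independent, sub-Gaussian with mean 0 and scale 1
    (hX_meas : ∀ i j, Measurable (fun ω => X ω i j))
    (hX_indep : iIndepFun (fun (q : Fin n × Fin p) ω => X ω q.1 q.2) μ)
    (hX_sub : ∀ i j, HasSubgaussianMGF (fun ω => X ω i j) 1 μ)
    -- the noise is independent of `X`, with independent entries, sub-Gaussian with mean 0, scale `σ`
    (hε_meas : ∀ i, Measurable (fun ω => ε ω i))
    (hε_indep : iIndepFun (fun i ω => ε ω i) μ)
    (hε_sub : ∀ i, HasSubgaussianMGF (fun ω => ε ω i) (σ ^ 2) μ)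
    (hXε : IndepFun (fun ω (q : Fin n × Fin p) => X ω q.1 q.2) ε μ)
    -- `β` has exactly `k` nonzero entries, and `kbar` is an upper bound for `max k 1`
    (k kbar : ℕ) (hk : (OMP.trueSupport β).card = k) (hkbar : max k 1 ≤ kbar)
    (lamMin lamMax lam : ℝ) (hlamMin : 0 < lamMin) (hlamMax : lamMin ≤ lamMax) (hlam : 0 < lam)
    (hlamMin_le_one : 1 ≤ k → lamMin ≤ 1)
    (a α δ : ℝ) (ha : 0 < a) (hα : 0 < α) (hδ : 0 < δ)
    (hn : (n : ℝ) = OMP.ξ σ lamMin lamMax lam kbar α δ * kbar * OMP.threshold a p ^ 2)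
    -- the rule that breaks ties in the argmax of the algorithm
    (sel : Finset (Fin p) → Fin p) (hsel : ∀ s : Finset (Fin p), s.Nonempty → sel s ∈ s)
    (Shat : Ω → Finset (Fin p))
    (hShat : ∀ ω, Shat ω =
      OMP.support sel (X ω) (OMP.response (X ω) β (ε ω)) (OMP.threshold a p))
    (perr : ℝ)
    (hperr : perr = OMP.Perr (μ.real (OMP.condFails X ε β σ lamMin lamMax lam)) a p k) :
    (1 ≤ k →
      μ.real {ω | ¬ (Shat ω ⊆ OMP.trueSupport β ∧
        ∑ j ∈ OMP.trueSupport β \ Shat ω, β j ^ 2 ≤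
          α * (OMP.trueSupport β \ Shat ω).card)} ≤ perr ∧
      ∀ βmin : ℝ, 0 < βmin → (∀ j ∈ OMP.trueSupport β, βmin ≤ |β j|) → α < βmin ^ 2 →
        1 - perr ≤ μ.real {ω | Shat ω = OMP.trueSupport β}) ∧
    (k = 0 → 1 - perr ≤ μ.real {ω | Shat ω = ∅}) := by
  have hperr0 : 0 ≤ perr := hperr ▸ OMP.Perr_nonneg measureReal_nonneg a p k
  constructor
  · intro hk1
    have hmain : μ.real {ω | ¬ (Shat ω ⊆ OMP.trueSupport β ∧
        ∑ j ∈ OMP.trueSupport β \ Shat ω, β j ^ 2 ≤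
          α * (OMP.trueSupport β \ Shat ω).card)} ≤ perr := by
      have hp : 0 < p := by
        have := Finset.card_le_univ (OMP.trueSupport β)
        rw [Fintype.card_fin] at this
        omega
      rw [hperr, OMP.Perr, if_neg (by omega)]
      rcases (show 1 ≤ p from hp).eq_or_lt with hp1 | hp1
      · -- for `p = 1` the asserted bound exceeds `1`
        refine measureReal_le_one.trans ?_
        subst hp1
        simp only [Nat.cast_one, Real.one_rpow, div_one]
        have : (0 : ℝ) ≤ k := Nat.cast_nonneg k
        have := measureReal_nonneg (μ := μ) (s := OMP.condFails X ε β σ lamMin lamMax lam)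
        linarith
      have hkbar1 : 1 ≤ kbar := (le_max_right k 1).trans hkbar
      have hle := hlamMin_le_one hk1
      -- the sample size is positive, since `ξ > 0` and `log p > 0`
      have hn0 : 0 < n := by
        rw [← Nat.cast_pos (α := ℝ), hn]
        have h1 : 0 < OMP.threshold a p ^ 2 := by
          rw [OMP.threshold_sq ha.le]
          have := Real.log_pos (show (1 : ℝ) < p by exact_mod_cast hp1)
          positivity
        have h2 : 0 < OMP.r₁ lamMin lamMax lam :=
          div_pos (lt_max_of_lt_right hlam) (by positivity)
        have h3 : 0 < OMP.ξ σ lamMin lamMax lam kbar α δ := lt_max_of_lt_left (by positivity)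
        have h4 : (0 : ℝ) < kbar := by exact_mod_cast hkbar1
        positivity
      have hnull := OMP.measureReal_false_positive_le hX_meas hX_indep hX_sub hε_meas hXε hsel
        ha.le hp β
      have hnoise := OMP.measureReal_noise_le hσ hX_meas hε_meas hε_indep hε_sub hXε ha.le hp
        (OMP.trueSupport β)
      rw [hk] at hnull hnoise
      refine le_trans ?_ (add_le_add (add_le_add le_rfl hnull) hnoise)
      refine le_trans (measureReal_mono fun ω hω => ?_) ((measureReal_union_le _ _).trans
        (add_le_add_left (measureReal_union_le _ _) _))
      by_contra hgood
      simp only [Set.mem_union, not_or] at hgood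
      obtain ⟨⟨hcond, hfp⟩, hno⟩ := hgood
      have hcond' := not_not.1 hcond
      have hfp' := not_not.1 hfp
      rw [← hShat ω] at hfp'
      exact hω ⟨hfp'.1, OMP.sum_missed_sq_le hlamMin hlamMax hlam hle hα hδ
        (hk.le.trans ((le_max_left k 1).trans hkbar)) hkbar1 hn0 hn hcond'.1 hcond'.2
        (not_not.1 hno) hfp'.1 fun j hj => hfp'.2 j (Finset.mem_sdiff.1 hj).2⟩
    refine ⟨hmain, fun βmin hβ0 hβ hαβ => ?_⟩
    refine le_trans (sub_le_sub_left hmain 1) (OMP.one_sub_measureReal_compl_le fun ω hω hrec => ?_)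
    exact hω (OMP.eq_trueSupport_of_sum_missed_le hβ0 hβ hαβ hrec.1 hrec.2)
  · intro hk0
    rcases Nat.eq_zero_or_pos p with hp | hp
    · -- without columns `2 / p ^ a` is the junk value `0`, but `∅` is the only possible output
      subst hp
      have : {ω | Shat ω = ∅} = Set.univ := Set.eq_univ_of_forall fun ω =>
        Finset.eq_empty_of_isEmpty (Shat ω)
      rw [this, probReal_univ]
      linarith
    · have hempty : OMP.trueSupport β = ∅ := Finset.card_eq_zero.1 (hk.trans hk0)
      have hnull := OMP.measureReal_false_positive_le hX_meas hX_indep hX_sub hε_meas hXε hsel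
        ha.le hp β
      rw [hk, hk0, Nat.cast_zero, zero_add, mul_one] at hnull
      rw [hperr, OMP.Perr, if_pos hk0]
      refine le_trans (sub_le_sub_left hnull 1)
        (OMP.one_sub_measureReal_compl_le fun ω hω hsub => ?_)
      rw [← hShat ω, hempty] at hsub
      exact hω (Finset.subset_empty.1 hsub.1)
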